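/- Let $(\breve N,\breve g)$ be a finite-dimensional smooth semi-Riemannian manifold with Levi-Civita connection $\breve\nabla$, and let $\breve P$ be a smooth $(1,1)$-tensor field on $\breve N$ with $\breve P^2=\breve P+I$ and $\breve g(\breve PX,Y)=\breve g(X,\breve PY)$ for all $X,Y$ (a Golden structure) which is parallel, $\breve\nabla_X(\breve PY)=\breve P\breve\nabla_XY$ (so $\breve N$ is a locally Golden semi-Riemannian manifold). Let $\acute N$ be an immersed lightlike submanifold of $\breve N$: the radical $\mathrm{Rad}\,T\acute N=T\acute N\cap T\acute N^{\perp}$ is a smooth distribution of constant rank $r\ge 1$. Let $S(T\acute N)$ be a smooth complement of $\mathrm{Rad}\,T\acute N$ in $T\acute N$, let $S(T\acute N^{\perp})$ be a smooth complement of $\mathrm{Rad}\,T\acute N$ in $T\acute N^{\perp}$, and let $ltr(T\acute N)$ be a smooth subbundle of $T\breve N|_{\acute N}$, orthogonal to $S(T\acute N)$ and to $S(T\acute N^{\perp})$, such that $tr(T\acute N)=ltr(T\acute N)\oplus S(T\acute N^{\perp})$ is a direct sum and a complement of $T\acute N$. Thus $$T\breve N|_{\acute N}=S(T\acute N)\perp[\mathrm{Rad}\,T\acute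 N\oplus ltr(T\acute N)]\perp S(T\acute N^{\perp}).$$ (It is not required that $ltr(T\acute N)$ be totally null.) Assume that $\acute N$ is radical transversal, i.e. $\breve P(\mathrm{Rad}\,T\acute N)=ltr(T\acute N)$ and $\breve P(S(T\acute N))=S(T\acute N)$. For $W,U\in\Gamma(T\acute N)$ and $V\in\Gamma(ltr(T\acute N))$ write $$\breve\nabla_UW=\nabla_UW+h^l(U,W)+h^s(U,W),\qquad \breve\nabla_UV=-A_VU+\nabla^l_UV+D^s(U,V),$$ where $\nabla_UW$ and $A_VU$ are tangent to $\acute N$, $h^l(U,W)$ and $\nabla^l_UV$ lie in $ltr(T\acute N)$, and $h^s(U,W)$ and $D^s(U,V)$ lie in $S(T\acute N^\perp)$. Let $T$ and $Q$ be the projections of $T\acute N=S(T\acute N)\oplus \mathrm{Rad}\,T\acute N$ onto $S(T\acute N)$ and $\mathrm{Rad}\,T\acute N$. Put $SW=\breve PTW$, $LW=\breve PQW$ and $(\nabla_US)W=\nabla_U(SW)-S(\nabla_UW)$. Let $K_1$ and $K_2$ be the projections onto $ltr(T\acute N)$ and $\mathrm{Rad}\,T\acute N$ in the decomposition of $T\breve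 N|_{\acute N}$ above. Then for all $W,U\in\Gamma(T\acute N)$: $$(\nabla_US)W=A_{LW}U+K_2\breve Ph^l(U,W),$$ $$h^s(U,SW)+D^s(U,LW)-\breve Ph^s(U,W)=0,$$ $$h^l(U,SW)+\nabla^l_ULW-L\nabla_UW-K_1\breve Ph^l(U,W)=0.$$ -/

import Mathlib

open scoped Manifold ContDiff Bundle Topology

noncomputable section

namespace GoldenLightlike

/-! Every finite-dimensional manifold (without boundary) is charted on its model vector space:
the ambient manifold `N` on `EN`, the submanifold `M` on `EM`. -/

section Ambient

variable {EN : Type*} [NormedAddCommGroup EN] [NormedSpace ℝ EN]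
  {N : Type*} [TopologicalSpace N] [ChartedSpace EN N] [IsManifold 𝓘(ℝ, EN) ∞ N]

variable (EN N) in
/-- A semi-Riemannian metric on `N`: a smooth symmetric nondegenerate `(0,2)`-tensor field. -/
structure SemiRiemannianMetric where
  val : ∀ p : N, TangentSpace 𝓘(ℝ, EN) p →L[ℝ] TangentSpace 𝓘(ℝ, EN) p →L[ℝ] ℝ
  symm : ∀ (p : N) (v w : TangentSpace 𝓘(ℝ, EN) p), val p v w = val p w v
  nondegenerate : ∀ (p : N) (v : TangentSpace 𝓘(ℝ, EN) p),
    (∀ w : TangentSpace 𝓘(ℝ, EN) p, val p v w = 0) → v = 0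
  contMDiff : ContMDiff 𝓘(ℝ, EN) (𝓘(ℝ, EN).prod 𝓘(ℝ, EN →L[ℝ] EN →L[ℝ] ℝ)) ∞
    (fun p : N => Bundle.TotalSpace.mk' (EN →L[ℝ] EN →L[ℝ] ℝ)
      (E := fun p : N => TangentSpace 𝓘(ℝ, EN) p →L[ℝ] TangentSpace 𝓘(ℝ, EN) p →L[ℝ] ℝ)
      p (val p))

/-- The orthogonal complement `{v | g(v, w) = 0 for all w ∈ D}` of a subspace of a tangent
space. -/
def SemiRiemannianMetric.orth (g : SemiRiemannianMetric EN N) {p : N}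
    (D : Submodule ℝ (TangentSpace 𝓘(ℝ, EN) p)) : Submodule ℝ (TangentSpace 𝓘(ℝ, EN) p) where
  carrier := {v | ∀ w ∈ D, g.val p v w = 0}
  add_mem' := by
    intro a b ha hb w hw
    simp [ha w hw, hb w hw]
  zero_mem' := by
    intro w _
    simp
  smul_mem' := by
    intro c a ha w hw
    simp [ha w hw]

/-- An affine connection `D` on `N`. As in Mathlib, `D Y p v` is the covariant derivative of the
vector field `Y` at `p` in the direction `v`. -/
abbrev AffineConnection (EN : Type*) [NormedAddCommGroup EN] [NormedSpace ℝ EN]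
    (N : Type*) [TopologicalSpace N] [ChartedSpace EN N] [IsManifold 𝓘(ℝ, EN) ∞ N] :=
  CovariantDerivative 𝓘(ℝ, EN) EN (TangentSpace 𝓘(ℝ, EN) : N → Type _)

/-- `D` is the Levi-Civita connection of `g`: it is torsion free,
`D_X Y - D_Y X = [X, Y]`, and metric, `v (g(Y, Z)) = g(D_v Y, Z) + g(Y, D_v Z)`. -/
structure IsLeviCivita (g : SemiRiemannianMetric EN N) (D : AffineConnection EN N) : Prop where
  torsion_free : ∀ (X Y : ∀ p : N, TangentSpace 𝓘(ℝ, EN) p) (p : N),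
    MDifferentiableAt 𝓘(ℝ, EN) 𝓘(ℝ, EN).tangent
      (fun q => (⟨q, X q⟩ : TangentBundle 𝓘(ℝ, EN) N)) p →
    MDifferentiableAt 𝓘(ℝ, EN) 𝓘(ℝ, EN).tangent
      (fun q => (⟨q, Y q⟩ : TangentBundle 𝓘(ℝ, EN) N)) p →
    D Y p (X p) - D X p (Y p) = VectorField.mlieBracket 𝓘(ℝ, EN) X Y p
  metric : ∀ (Y Z : ∀ p : N, TangentSpace 𝓘(ℝ, EN) p) (p : N) (v : TangentSpace 𝓘(ℝ, EN) p),
    MDifferentiableAt 𝓘(ℝ, EN) 𝓘(ℝ, EN).tangent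
      (fun q => (⟨q, Y q⟩ : TangentBundle 𝓘(ℝ, EN) N)) p →
    MDifferentiableAt 𝓘(ℝ, EN) 𝓘(ℝ, EN).tangent
      (fun q => (⟨q, Z q⟩ : TangentBundle 𝓘(ℝ, EN) N)) p →
    mvfderiv 𝓘(ℝ, EN) (fun q => g.val q (Y q) (Z q)) p v
      = g.val p (D Y p v) (Z p) + g.val p (Y p) (D Z p v)

/-- A Golden structure on `(N, g)`: a smooth `(1,1)`-tensor field `P` with `P² = P + I` with which
`g` is compatible, `g(P v, w) = g(v, P w)`. So `(N, g, P)` is a Golden semi-Riemannian manifold. -/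
structure GoldenStructure (g : SemiRiemannianMetric EN N) where
  P : ∀ p : N, TangentSpace 𝓘(ℝ, EN) p →L[ℝ] TangentSpace 𝓘(ℝ, EN) p
  contMDiff : ContMDiff 𝓘(ℝ, EN) (𝓘(ℝ, EN).prod 𝓘(ℝ, EN →L[ℝ] EN)) ∞
    (fun p : N => Bundle.TotalSpace.mk' (EN →L[ℝ] EN)
      (E := fun p : N => TangentSpace 𝓘(ℝ, EN) p →L[ℝ] TangentSpace 𝓘(ℝ, EN) p) p (P p))
  golden : ∀ (p : N) (v : TangentSpace 𝓘(ℝ, EN) p), P p (P p v) = P p v + v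
  compatible : ∀ (p : N) (v w : TangentSpace 𝓘(ℝ, EN) p), g.val p (P p v) w = g.val p v (P p w)

/-- The Golden structure is locally Golden with respect to the (Levi-Civita) connection `D`:
`P` is parallel, `D_v (P Y) = P (D_v Y)`. -/
def GoldenStructure.IsLocallyGolden {g : SemiRiemannianMetric EN N} (G : GoldenStructure g)
    (D : AffineConnection EN N) : Prop :=
  ∀ (Y : ∀ p : N, TangentSpace 𝓘(ℝ, EN) p) (p : N) (v : TangentSpace 𝓘(ℝ, EN) p),
    MDifferentiableAt 𝓘(ℝ, EN) 𝓘(ℝ, EN).tangent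
      (fun q => (⟨q, Y q⟩ : TangentBundle 𝓘(ℝ, EN) N)) p →
    D (fun q => G.P q (Y q)) p v = G.P p (D Y p v)

end Ambient

section Along

variable {EN : Type*} [NormedAddCommGroup EN] [NormedSpace ℝ EN]
  {N : Type*} [TopologicalSpace N] [ChartedSpace EN N] [IsManifold 𝓘(ℝ, EN) ∞ N]
  {EM : Type*} [NormedAddCommGroup EM] [NormedSpace ℝ EM]
  {M : Type*} [TopologicalSpace M] [ChartedSpace EM M]

variable (EN) in
/-- Sections, not necessarily smooth, of `TN|_M`, i.e. of the pullback of `TN` by `f`. -/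
abbrev SectionAlong (f : M → N) := ∀ x : M, TangentSpace 𝓘(ℝ, EN) (f x)

/-- The derivative `D_v σ` of a section `σ` of `TN|_M` in directions `v` tangent to `M` (the
pullback connection). In the trivialization of `TN` around `f x`, write `σ(y)` as the value at
`f y` of the frame-constant vector field with coefficients `c(y)`. The Leibniz rule then gives
`D_v σ = (dc(v)`, read in `T_{f x} N) + D_{df(v)} Y`, where `Y` is the vector field with constant
coefficients `c(x)`, which is Mathlib's `FiberBundle.extend EN (σ x)`. -/
def covAlong (EM : Type*) [NormedAddCommGroup EM] [NormedSpace ℝ EM]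
    {M : Type*} [TopologicalSpace M] [ChartedSpace EM M]
    (D : AffineConnection EN N) (f : M → N) (σ : SectionAlong EN f) (x : M) :
    TangentSpace 𝓘(ℝ, EM) x →L[ℝ] TangentSpace 𝓘(ℝ, EN) (f x) :=
  ((trivializationAt EN (TangentSpace 𝓘(ℝ, EN) : N → Type _) (f x)).symmL ℝ (f x)).comp
      (mvfderiv 𝓘(ℝ, EM) (fun y : M =>
        ((trivializationAt EN (TangentSpace 𝓘(ℝ, EN) : N → Type _) (f x))
          (⟨f y, σ y⟩ : TangentBundle 𝓘(ℝ, EN) N)).2) x)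
    + (D (FiberBundle.extend EN (σ x)) (f x)).comp (mfderiv 𝓘(ℝ, EM) 𝓘(ℝ, EN) f x)

/-- A family of subspaces of the spaces `T_{f x} N` is a smooth subbundle of `TN|_M`: around each
point of `M` it has a finite smooth local frame. -/
def IsSmoothSubbundle (EM : Type*) [NormedAddCommGroup EM] [NormedSpace ℝ EM]
    {M : Type*} [TopologicalSpace M] [ChartedSpace EM M] {f : M → N}
    (B : ∀ x : M, Submodule ℝ (TangentSpace 𝓘(ℝ, EN) (f x))) : Prop :=
  ∀ x₀ : M, ∃ (U : Set M) (k : ℕ) (s : Fin k → SectionAlong EN f), IsOpen U ∧ x₀ ∈ U ∧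
    (∀ i, ContMDiffOn 𝓘(ℝ, EM) 𝓘(ℝ, EN).tangent ∞
      (fun y => (⟨f y, s i y⟩ : TangentBundle 𝓘(ℝ, EN) N)) U) ∧
    ∀ y ∈ U, LinearIndependent ℝ (fun i => s i y) ∧
      Submodule.span ℝ (Set.range fun i => s i y) = B y

/-- The tangent space of `M` at `x`, as a subspace of `T_{f x} N`. -/
def tan (EM : Type*) [NormedAddCommGroup EM] [NormedSpace ℝ EM]
    {M : Type*} [TopologicalSpace M] [ChartedSpace EM M] (f : M → N) (x : M) :
    Submodule ℝ (TangentSpace 𝓘(ℝ, EN) (f x)) :=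
  LinearMap.range (mfderiv 𝓘(ℝ, EM) 𝓘(ℝ, EN) f x).toLinearMap

/-- A vector field on `M`, as a section of `TN|_M`. -/
def push (f : M → N) (W : ∀ x : M, TangentSpace 𝓘(ℝ, EM) x) : SectionAlong EN f :=
  fun x => mfderiv 𝓘(ℝ, EM) 𝓘(ℝ, EN) f x (W x)

/-- The radical `Rad T_x M = T_x M ∩ (T_x M)^⊥`. -/
def rad (EM : Type*) [NormedAddCommGroup EM] [NormedSpace ℝ EM]
    {M : Type*} [TopologicalSpace M] [ChartedSpace EM M]
    (g : SemiRiemannianMetric EN N) (f : M → N) (x : M) :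
    Submodule ℝ (TangentSpace 𝓘(ℝ, EN) (f x)) :=
  tan EM f x ⊓ g.orth (tan EM f x)

/-- An immersed `r`-lightlike submanifold `f : M → N` of `(N, g)`, `1 ≤ r`, with a screen
distribution `S(TM)`, a screen transversal bundle `S(TM^⊥)` and a lightlike transversal
bundle `ltr(TM)`, so that
`TN|_M = S(TM) ⊥ (Rad TM ⊕ ltr(TM)) ⊥ S(TM^⊥)` and `tr(TM) = ltr(TM) ⊥ S(TM^⊥)` is a complement
of `TM`.

The orthogonality of `Rad TM` to `S(TM)` and to `S(TM^⊥)`, that of `S(TM)` to `S(TM^⊥)`, and the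
nondegeneracy of `g` on these two bundles follow from the fields. It is *not* required that
`ltr(TM)` be totally null; the usual choice of a totally null `ltr(TM)` is a special case. -/
structure LightlikeSubmanifold (EM : Type*) [NormedAddCommGroup EM] [NormedSpace ℝ EM]
    {M : Type*} [TopologicalSpace M] [ChartedSpace EM M]
    (g : SemiRiemannianMetric EN N) (f : M → N) where
  immersion : Manifold.IsImmersion 𝓘(ℝ, EM) 𝓘(ℝ, EN) ∞ f
  r : ℕ
  one_le_r : 1 ≤ r
  finrank_rad : ∀ x, Module.finrank ℝ (rad EM g f x) = r
  smooth_rad : IsSmoothSubbundle EM (rad EM g f)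
  /-- the screen distribution `S(TM)` -/
  screen : ∀ x : M, Submodule ℝ (TangentSpace 𝓘(ℝ, EN) (f x))
  smooth_screen : IsSmoothSubbundle EM screen
  screen_disjoint : ∀ x, Disjoint (screen x) (rad EM g f x)
  screen_sup : ∀ x, screen x ⊔ rad EM g f x = tan EM f x
  /-- the screen transversal bundle `S(TM^⊥)` -/
  screenTrans : ∀ x : M, Submodule ℝ (TangentSpace 𝓘(ℝ, EN) (f x))
  smooth_screenTrans : IsSmoothSubbundle EM screenTrans
  screenTrans_disjoint : ∀ x, Disjoint (screenTrans x) (rad EM g f x)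
  screenTrans_sup : ∀ x, screenTrans x ⊔ rad EM g f x = g.orth (tan EM f x)
  /-- the lightlike transversal bundle `ltr(TM)` -/
  ltr : ∀ x : M, Submodule ℝ (TangentSpace 𝓘(ℝ, EN) (f x))
  smooth_ltr : IsSmoothSubbundle EM ltr
  ltr_orth_screen : ∀ x, ltr x ≤ g.orth (screen x)
  ltr_orth_screenTrans : ∀ x, ltr x ≤ g.orth (screenTrans x)
  ltr_disjoint : ∀ x, Disjoint (ltr x) (screenTrans x)
  isCompl_tan : ∀ x, IsCompl (tan EM f x) (ltr x ⊔ screenTrans x)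

namespace LightlikeSubmanifold

variable {g : SemiRiemannianMetric EN N} {f : M → N} (L : LightlikeSubmanifold EM g f)

theorem isCompl_screen (x : M) :
    IsCompl (L.screen x) (rad EM g f x ⊔ (L.ltr x ⊔ L.screenTrans x)) :=
  (L.screen_disjoint x).isCompl_sup_right_of_isCompl_sup_left
    ((L.screen_sup x).symm ▸ L.isCompl_tan x)

theorem isCompl_rad (x : M) :
    IsCompl (rad EM g f x) (L.screen x ⊔ (L.ltr x ⊔ L.screenTrans x)) :=
  (L.screen_disjoint x).symm.isCompl_sup_right_of_isCompl_sup_left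
    (by rw [sup_comm, L.screen_sup x]; exact L.isCompl_tan x)

theorem isCompl_ltr (x : M) : IsCompl (L.ltr x) (L.screenTrans x ⊔ tan EM f x) :=
  (L.ltr_disjoint x).isCompl_sup_right_of_isCompl_sup_left (L.isCompl_tan x).symm

theorem isCompl_screenTrans (x : M) : IsCompl (L.screenTrans x) (L.ltr x ⊔ tan EM f x) :=
  (L.ltr_disjoint x).symm.isCompl_sup_right_of_isCompl_sup_left
    (by rw [sup_comm (L.screenTrans x)]; exact (L.isCompl_tan x).symm)

/-! The projections belonging to
`T_{f x} N = T_x M ⊕ ltr ⊕ S(TM^⊥) = S(TM) ⊕ Rad ⊕ ltr ⊕ S(TM^⊥)`. -/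

/-- the tangential component -/
def toTan (x : M) : TangentSpace 𝓘(ℝ, EN) (f x) →ₗ[ℝ] TangentSpace 𝓘(ℝ, EN) (f x) :=
  Submodule.projection _ _ (L.isCompl_tan x)

/-- the `S(TM)`-component; on `TM` it is the projection `T` -/
def toScreen (x : M) : TangentSpace 𝓘(ℝ, EN) (f x) →ₗ[ℝ] TangentSpace 𝓘(ℝ, EN) (f x) :=
  Submodule.projection _ _ (L.isCompl_screen x)

/-- the `Rad TM`-component; on `TM` it is the projection `Q`, on `P ltr(TM)` it is `K₂` -/
def toRad (x : M) : TangentSpace 𝓘(ℝ, EN) (f x) →ₗ[ℝ] TangentSpace 𝓘(ℝ, EN) (f x) :=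
  Submodule.projection _ _ (L.isCompl_rad x)

/-- the `ltr(TM)`-component; on `P ltr(TM)` it is `K₁` -/
def toLtr (x : M) : TangentSpace 𝓘(ℝ, EN) (f x) →ₗ[ℝ] TangentSpace 𝓘(ℝ, EN) (f x) :=
  Submodule.projection _ _ (L.isCompl_ltr x)

/-- the `S(TM^⊥)`-component -/
def toScreenTrans (x : M) : TangentSpace 𝓘(ℝ, EN) (f x) →ₗ[ℝ] TangentSpace 𝓘(ℝ, EN) (f x) :=
  Submodule.projection _ _ (L.isCompl_screenTrans x)

/-! The Gauss and Weingarten formulas, for the connection `D` of `N`. `U` is a vector field on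
`M`; `σ` stands for a section of `TM`, seen inside `TN|_M`, and `V` for a section of `ltr(TM)`:
`D_U σ = ∇_U σ + h^l(U, σ) + h^s(U, σ)` and `D_U V = - A_V U + ∇^l_U V + D^s(U, V)`. -/

variable (D : AffineConnection EN N) (U : ∀ x : M, TangentSpace 𝓘(ℝ, EM) x)

/-- the induced connection `∇_U σ` -/
def nabla (σ : SectionAlong EN f) : SectionAlong EN f :=
  fun x => L.toTan x (covAlong EM D f σ x (U x))

/-- the lightlike second fundamental form `h^l(U, σ)` -/
def hl (σ : SectionAlong EN f) : SectionAlong EN f :=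
  fun x => L.toLtr x (covAlong EM D f σ x (U x))

/-- the screen second fundamental form `h^s(U, σ)` -/
def hs (σ : SectionAlong EN f) : SectionAlong EN f :=
  fun x => L.toScreenTrans x (covAlong EM D f σ x (U x))

/-- the shape operator `A_V U` -/
def shape (V : SectionAlong EN f) : SectionAlong EN f :=
  fun x => - L.toTan x (covAlong EM D f V x (U x))

/-- the connection `∇^l_U V` on `ltr(TM)` -/
def nablaL (V : SectionAlong EN f) : SectionAlong EN f :=
  fun x => L.toLtr x (covAlong EM D f V x (U x))

/-- the form `D^s(U, V)` -/
def Ds (V : SectionAlong EN f) : SectionAlong EN f :=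
  fun x => L.toScreenTrans x (covAlong EM D f V x (U x))

variable (G : GoldenStructure g)

/-- `S σ = P (T σ)` for a section `σ` of `TM` -/
def opS (σ : SectionAlong EN f) : SectionAlong EN f :=
  fun x => G.P (f x) (L.toScreen x (σ x))

/-- `L σ = P (Q σ)` for a section `σ` of `TM` -/
def opL (σ : SectionAlong EN f) : SectionAlong EN f :=
  fun x => G.P (f x) (L.toRad x (σ x))

/-- `(∇_U S) σ = ∇_U (S σ) - S (∇_U σ)` -/
def nablaS (σ : SectionAlong EN f) : SectionAlong EN f :=
  fun x => L.nabla D U (L.opS G σ) x - L.opS G (L.nabla D U σ) x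

/-- `M` is a radical transversal lightlike submanifold of `(N, g, P)`:
`P (Rad TM) = ltr(TM)` and `P (S(TM)) = S(TM)`. -/
structure IsRadicalTransversal : Prop where
  map_rad : ∀ x, (rad EM g f x).map (G.P (f x)).toLinearMap = L.ltr x
  map_screen : ∀ x, (L.screen x).map (G.P (f x)).toLinearMap = L.screen x

end LightlikeSubmanifold

end Along

end GoldenLightlike

end

noncomputable section

namespace GoldenLightlike

/-! ### Derivatives of vector-valued maps on a manifold. -/

section VectorDerivative

variable {E : Type*} [NormedAddCommGroup E] [NormedSpace ℝ E]
  {H : Type*} [TopologicalSpace H] {I : ModelWithCorners ℝ E H}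
  {M : Type*} [TopologicalSpace M] [ChartedSpace H M]
  {F F' : Type*} [NormedAddCommGroup F] [NormedSpace ℝ F]
  [NormedAddCommGroup F'] [NormedSpace ℝ F']

/-! Write w = Tw + Qw and apply P, so that Pw = Sw + Lw. Since P is parallel, differentiating along
M gives D_U(Sw) + D_U(Lw) = P(D_U w), and the three formulas are the components of this identity in
TM ⊕ ltr ⊕ S(TM^⊥).

Splitting the right side needs the action of P on each summand. On TM it is S + L, with values in
S(TM) and ltr. On ltr = P(Rad), the golden relation P(Pξ) = Pξ + ξ gives Pl = l + (Pl - l) with Pl -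
l in Rad, so P(ltr) lies in Rad ⊕ ltr. Finally P preserves S(TM^⊥): that bundle is the orthogonal
complement of TM ⊕ ltr, and P is self-adjoint and maps TM ⊕ ltr into itself. `components_apply`
collects these facts.

The analytic side has two points. Parallelism is assumed for fields on N, and `covAlong_endo`
transfers it to sections along f by comparing coefficients in a trivialization. Splitting D_U(Pw)
also requires Tw and Qw to be differentiable, which `DiffAlongAt.left_of_add` derives from local
frames. -/

theorem mvfderiv_congr_of_eventuallyEq {a b : M → F} {x : M} (h : a =ᶠ[𝓝 x] b) :
    mvfderiv I a x = mvfderiv I b x := by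
  ext v
  simp only [mvfderiv, h.mfderiv_eq]
  rfl

theorem mvfderiv_clm_apply {A : M → F →L[ℝ] F'} {c : M → F} {x : M}
    (hA : MDifferentiableAt I 𝓘(ℝ, F →L[ℝ] F') A x) (hc : MDifferentiableAt I 𝓘(ℝ, F) c x)
    (v : TangentSpace I x) :
    mvfderiv I (fun y => A y (c y)) x v
      = mvfderiv I A x v (c x) + A x (mvfderiv I c x v) := by
  have h := hA.hasMFDerivAt.2.clm_apply hc.hasMFDerivAt.2
  have h' : HasMFDerivAt I 𝓘(ℝ, F') (fun y => A y (c y)) x _ :=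
    ⟨hA.continuousAt.clm_apply hc.continuousAt, h⟩
  simp only [mvfderiv, h'.mfderiv]
  simp [writtenInExtChartAt]
  exact add_comm _ _

end VectorDerivative

/-! ### The pullback connection in a trivialization. -/

section Pullback

variable {EN : Type*} [NormedAddCommGroup EN] [NormedSpace ℝ EN]
  {N : Type*} [TopologicalSpace N] [ChartedSpace EN N] [IsManifold 𝓘(ℝ, EN) ∞ N]
  {EM : Type*} [NormedAddCommGroup EM] [NormedSpace ℝ EM]
  {M : Type*} [TopologicalSpace M] [ChartedSpace EM M]

/-- The coefficients of a section of `TN|_M` in the trivialization of `TN` around `f x`. -/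
def coordAlong (f : M → N) (x : M) (σ : SectionAlong EN f) (y : M) : EN :=
  ((trivializationAt EN (TangentSpace 𝓘(ℝ, EN) : N → Type _) (f x))
    (⟨f y, σ y⟩ : TangentBundle 𝓘(ℝ, EN) N)).2

/-- Differentiability at `x` of a section of `TN|_M`. -/
abbrev DiffAlongAt (EM : Type*) [NormedAddCommGroup EM] [NormedSpace ℝ EM]
    {M : Type*} [TopologicalSpace M] [ChartedSpace EM M]
    (f : M → N) (σ : SectionAlong EN f) (x : M) : Prop :=
  MDifferentiableAt 𝓘(ℝ, EM) 𝓘(ℝ, EN).tangent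
    (fun y => (⟨f y, σ y⟩ : TangentBundle 𝓘(ℝ, EN) N)) x

theorem diffAlongAt_iff {f : M → N} {σ : SectionAlong EN f} {x : M} :
    DiffAlongAt EM f σ x ↔ MDifferentiableAt 𝓘(ℝ, EM) 𝓘(ℝ, EN) f x ∧
      MDifferentiableAt 𝓘(ℝ, EM) 𝓘(ℝ, EN) (coordAlong f x σ) x :=
  mdifferentiableAt_totalSpace (IB := 𝓘(ℝ, EN)) (IM := 𝓘(ℝ, EM)) (F := EN)
    (E := (TangentSpace 𝓘(ℝ, EN) : N → Type _))
    (fun y => (⟨f y, σ y⟩ : TangentBundle 𝓘(ℝ, EN) N)) (x₀ := x)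

variable (EN) in
theorem eventually_mem_baseSet {f : M → N} {x : M} (hf : ContinuousAt f x) :
    ∀ᶠ y in 𝓝 x,
      f y ∈ (trivializationAt EN (TangentSpace 𝓘(ℝ, EN) : N → Type _) (f x)).baseSet :=
  hf ((trivializationAt EN (TangentSpace 𝓘(ℝ, EN) : N → Type _) (f x)).open_baseSet.mem_nhds
    (FiberBundle.mem_baseSet_trivializationAt' (f x)))

omit [TopologicalSpace M] in
theorem coordAlong_eq {f : M → N} {x y : M} (σ : SectionAlong EN f)
    (hy : f y ∈ (trivializationAt EN (TangentSpace 𝓘(ℝ, EN) : N → Type _) (f x)).baseSet) :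
    coordAlong f x σ y = (trivializationAt EN (TangentSpace 𝓘(ℝ, EN) : N → Type _)
      (f x)).continuousLinearEquivAt ℝ (f y) hy (σ y) :=
  rfl

theorem covAlong_eq (D : AffineConnection EN N) (f : M → N) (σ : SectionAlong EN f) (x : M)
    (v : TangentSpace 𝓘(ℝ, EM) x) :
    covAlong EM D f σ x v =
      (trivializationAt EN (TangentSpace 𝓘(ℝ, EN) : N → Type _) (f x)).symmL ℝ (f x)
        (mvfderiv 𝓘(ℝ, EM) (coordAlong f x σ) x v)
      + D (FiberBundle.extend EN (σ x)) (f x) (mfderiv 𝓘(ℝ, EM) 𝓘(ℝ, EN) f x v) :=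
  rfl

theorem mvfderiv_coordAlong_add {f : M → N} {σ τ : SectionAlong EN f} {x : M}
    (hσ : DiffAlongAt EM f σ x) (hτ : DiffAlongAt EM f τ x) :
    mvfderiv 𝓘(ℝ, EM) (coordAlong f x (σ + τ)) x
      = mvfderiv 𝓘(ℝ, EM) (coordAlong f x σ) x + mvfderiv 𝓘(ℝ, EM) (coordAlong f x τ) x := by
  have hσ := (diffAlongAt_iff (EN := EN)).1 hσ
  have hτ := (diffAlongAt_iff (EN := EN)).1 hτ
  rw [← mvfderiv_add hσ.2 hτ.2]
  apply mvfderiv_congr_of_eventuallyEq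
  filter_upwards [eventually_mem_baseSet EN hσ.1.continuousAt] with y hy
  simp only [Pi.add_apply, coordAlong_eq _ hy, map_add]

/-- This is the Leibniz rule that makes coefficientwise differentiation a covariant derivative in
`connection_eq_mvfderiv_add`. The trivialization is linear only over its base set, hence the passage
to germs. -/
theorem mvfderiv_coordAlong_smul {f : M → N} {σ : SectionAlong EN f} {a : M → ℝ} {x : M}
    (hσ : DiffAlongAt EM f σ x) (ha : MDifferentiableAt 𝓘(ℝ, EM) 𝓘(ℝ, ℝ) a x) :
    mvfderiv 𝓘(ℝ, EM) (coordAlong f x (fun y => a y • σ y)) x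
      = a x • mvfderiv 𝓘(ℝ, EM) (coordAlong f x σ) x
        + (mvfderiv 𝓘(ℝ, EM) a x).smulRight (coordAlong f x σ x) := by
  have hσ := (diffAlongAt_iff (EN := EN)).1 hσ
  rw [← mvfderiv_smul ha hσ.2]
  apply mvfderiv_congr_of_eventuallyEq
  filter_upwards [eventually_mem_baseSet EN hσ.1.continuousAt] with y hy
  simp [coordAlong_eq _ hy]

theorem coordAlong_extend (p : N) (v : TangentSpace 𝓘(ℝ, EN) p) :
    coordAlong (fun q : N => q) p
        (FiberBundle.extend (E := (TangentSpace 𝓘(ℝ, EN) : N → Type _)) EN v)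
      =ᶠ[𝓝 p] fun _ => ((trivializationAt EN (TangentSpace 𝓘(ℝ, EN) : N → Type _) p)
        (⟨p, v⟩ : TangentBundle 𝓘(ℝ, EN) N)).2 := by
  filter_upwards [eventually_mem_baseSet EN (f := fun q : N => q) continuousAt_id]
    with q hq
  simp only [coordAlong, FiberBundle.extend]
  rw [Bundle.Trivialization.apply_mk_symm _ hq]

theorem mdifferentiableAt_extend (p : N) (v : TangentSpace 𝓘(ℝ, EN) p) :
    MDifferentiableAt 𝓘(ℝ, EN) 𝓘(ℝ, EN).tangent (fun q => (⟨q,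
      FiberBundle.extend (E := (TangentSpace 𝓘(ℝ, EN) : N → Type _)) EN v q⟩ :
        TangentBundle 𝓘(ℝ, EN) N)) p :=
  FiberBundle.mdifferentiableAt_extend 𝓘(ℝ, EN) EN v

/-- Constant-coefficient extension is additive over the base set of the trivialization at p, and a
connection depends only on the germ of the field. -/
theorem connection_extend_add (D : AffineConnection EN N) (p : N)
    (v w : TangentSpace 𝓘(ℝ, EN) p) :
    D (FiberBundle.extend EN (v + w)) p
      = D (FiberBundle.extend EN v) p + D (FiberBundle.extend EN w) p := by
  rw [← D.isCovariantDerivativeOnUniv.add (mdifferentiableAt_extend p v)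
    (mdifferentiableAt_extend p w)]
  refine D.isCovariantDerivativeOnUniv.congr_of_eventuallyEq (mdifferentiableAt_extend p _)
    (mdifferentiableAt_add_section (mdifferentiableAt_extend p v) (mdifferentiableAt_extend p w))
    Filter.univ_mem ?_
  filter_upwards [eventually_mem_baseSet EN (f := fun q : N => q) continuousAt_id] with q hq
  have h := ((trivializationAt EN (TangentSpace 𝓘(ℝ, EN) : N → Type _) p).linear ℝ
    (FiberBundle.mem_baseSet_trivializationAt' p)).map_add v w
  have key := (trivializationAt EN (TangentSpace 𝓘(ℝ, EN) : N → Type _) p).symmL_apply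
    (R := ℝ) hq
  simp only [FiberBundle.extend, Pi.add_apply, h]
  rw [← key, ← key, ← key]
  exact map_add _ _ _

theorem covAlong_add (D : AffineConnection EN N) {f : M → N} {σ τ : SectionAlong EN f} {x : M}
    (hσ : DiffAlongAt EM f σ x) (hτ : DiffAlongAt EM f τ x) :
    covAlong EM D f (σ + τ) x = covAlong EM D f σ x + covAlong EM D f τ x := by
  ext v
  rw [add_apply]
  simp only [covAlong_eq]
  rw [mvfderiv_coordAlong_add hσ hτ, Pi.add_apply, connection_extend_add]
  simp only [add_apply, map_add]
  abel

/-! ### Parallel endomorphisms commute with the pullback connection. -/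

variable [FiniteDimensional ℝ EN]

/-- A connection of `N`, expressed in the trivialization of `TN` around `p`. -/
theorem connection_eq_mvfderiv_add (D : AffineConnection EN N)
    {Y : ∀ q : N, TangentSpace 𝓘(ℝ, EN) q} {p : N}
    (hY : DiffAlongAt EN (fun q : N => q) Y p) (v : TangentSpace 𝓘(ℝ, EN) p) :
    D Y p v =
      (trivializationAt EN (TangentSpace 𝓘(ℝ, EN) : N → Type _) p).symmL ℝ p
        (mvfderiv 𝓘(ℝ, EN) (coordAlong (fun q : N => q) p Y) p v)
      + D (FiberBundle.extend EN (Y p)) p v := by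
  -- The trivialization changes with the point q. This is harmless, because the axioms are pointwise
  -- and each is checked with q fixed.
  have hflat : IsCovariantDerivativeOn (I := 𝓘(ℝ, EN)) EN
      (fun (σ : ∀ q : N, TangentSpace 𝓘(ℝ, EN) q) (q : N) =>
        ((trivializationAt EN (TangentSpace 𝓘(ℝ, EN) : N → Type _) q).symmL ℝ q).comp
          (mvfderiv 𝓘(ℝ, EN) (coordAlong (fun q : N => q) q σ) q)) Set.univ := by
    constructor
    · intro σ τ x hσ hτ _
      rw [mvfderiv_coordAlong_add (f := fun q : N => q) hσ hτ, ContinuousLinearMap.comp_add]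
    · intro σ a x hσ ha _
      have h := mvfderiv_coordAlong_smul (f := fun q : N => q) hσ ha
      change mvfderiv 𝓘(ℝ, EN) (coordAlong (fun q : N => q) x (a • σ)) x = _ at h
      rw [h]
      ext w
      have h2 : (trivializationAt EN (TangentSpace 𝓘(ℝ, EN) : N → Type _) x).symmL ℝ x
          (coordAlong (fun q : N => q) x σ x) = σ x := by
        have hx := FiberBundle.mem_baseSet_trivializationAt' (F := EN)
          (E := (TangentSpace 𝓘(ℝ, EN) : N → Type _)) x
        rw [coordAlong_eq (f := fun q : N => q) σ hx,
          ← Bundle.Trivialization.symm_continuousLinearEquivAt_eq _ hx]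
        exact ContinuousLinearEquiv.symm_apply_apply _ _
      simp only [ContinuousLinearMap.comp_apply, add_apply,
        smul_apply, map_add, map_smul, ContinuousLinearMap.smulRight_apply, h2]
  have hE := mdifferentiableAt_extend p (Y p)
  -- The difference of two connections is tensorial, so at p it has the same value on Y and on the
  -- extension of Y p. The coefficients of that extension are constant near p, so its flat
  -- derivative vanishes.
  have h1 := IsCovariantDerivativeOn.difference_apply D.isCovariantDerivativeOnUniv hflat
    (Set.mem_univ p) hY
  have h2 := IsCovariantDerivativeOn.difference_apply D.isCovariantDerivativeOnUniv hflat
    (Set.mem_univ p) hE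
  rw [FiberBundle.extend_apply_self] at h2
  have h3 := h1.symm.trans h2
  rw [mvfderiv_congr_of_eventuallyEq (coordAlong_extend p (Y p)), mvfderiv_const] at h3
  have h4 := congrArg (fun A => A v) h3
  simp only [sub_apply, ContinuousLinearMap.comp_zero, sub_zero] at h4
  rw [sub_eq_iff_eq_add'] at h4
  exact h4

/-- A field of endomorphisms of the tangent spaces of `N`, in the trivialization around `p`. -/
def endoCoord (p : N) (P : ∀ q : N, TangentSpace 𝓘(ℝ, EN) q →L[ℝ] TangentSpace 𝓘(ℝ, EN) q)
    (q : N) : EN →L[ℝ] EN :=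
  ContinuousLinearMap.inCoordinates EN (TangentSpace 𝓘(ℝ, EN) : N → Type _) EN
    (TangentSpace 𝓘(ℝ, EN) : N → Type _) p q p q (P q)

omit [FiniteDimensional ℝ EN] in
theorem coordAlong_endo {P : ∀ q : N, TangentSpace 𝓘(ℝ, EN) q →L[ℝ] TangentSpace 𝓘(ℝ, EN) q}
    {f : M → N} (σ : SectionAlong EN f) {x : M} (hf : ContinuousAt f x) :
    coordAlong f x (fun y => P (f y) (σ y)) =ᶠ[𝓝 x]
      fun y => endoCoord (f x) P (f y) (coordAlong f x σ y) := by
  filter_upwards [eventually_mem_baseSet EN hf] with y hy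
  rw [endoCoord, ContinuousLinearMap.inCoordinates_eq hy hy, coordAlong_eq _ hy,
    coordAlong_eq _ hy]
  simp only [ContinuousLinearMap.comp_apply, ContinuousLinearEquiv.coe_coe,
    ContinuousLinearEquiv.symm_apply_apply]

omit [FiniteDimensional ℝ EN] in
theorem symmL_endoCoord
    (P : ∀ q : N, TangentSpace 𝓘(ℝ, EN) q →L[ℝ] TangentSpace 𝓘(ℝ, EN) q) (p : N) (c : EN) :
    (trivializationAt EN (TangentSpace 𝓘(ℝ, EN) : N → Type _) p).symmL ℝ p (endoCoord p P p c)
      = P p ((trivializationAt EN (TangentSpace 𝓘(ℝ, EN) : N → Type _) p).symmL ℝ p c) := by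
  have hp := FiberBundle.mem_baseSet_trivializationAt' (F := EN)
    (E := (TangentSpace 𝓘(ℝ, EN) : N → Type _)) p
  rw [endoCoord, ContinuousLinearMap.inCoordinates_eq hp hp,
    ← Bundle.Trivialization.symm_continuousLinearEquivAt_eq _ hp]
  simp only [ContinuousLinearMap.comp_apply, ContinuousLinearEquiv.coe_coe,
    ContinuousLinearEquiv.symm_apply_apply]

/-- An endomorphism field of `TN` which is parallel on `N` commutes with the pullback
connection. -/
theorem covAlong_endo (D : AffineConnection EN N)
    {P : ∀ q : N, TangentSpace 𝓘(ℝ, EN) q →L[ℝ] TangentSpace 𝓘(ℝ, EN) q}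
    (hP : ContMDiff 𝓘(ℝ, EN) (𝓘(ℝ, EN).prod 𝓘(ℝ, EN →L[ℝ] EN)) ∞
      (fun p : N => Bundle.TotalSpace.mk' (EN →L[ℝ] EN)
        (E := fun p : N => TangentSpace 𝓘(ℝ, EN) p →L[ℝ] TangentSpace 𝓘(ℝ, EN) p) p (P p)))
    (hDP : ∀ (Y : ∀ p : N, TangentSpace 𝓘(ℝ, EN) p) (p : N) (v : TangentSpace 𝓘(ℝ, EN) p),
      MDifferentiableAt 𝓘(ℝ, EN) 𝓘(ℝ, EN).tangent
        (fun q => (⟨q, Y q⟩ : TangentBundle 𝓘(ℝ, EN) N)) p →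
      D (fun q => P q (Y q)) p v = P p (D Y p v))
    {f : M → N} {σ : SectionAlong EN f} {x : M} (hσ : DiffAlongAt EM f σ x)
    (v : TangentSpace 𝓘(ℝ, EM) x) :
    covAlong EM D f (fun y => P (f y) (σ y)) x v = P (f x) (covAlong EM D f σ x v) := by
  obtain ⟨hf, hc⟩ := (diffAlongAt_iff (EN := EN)).1 hσ
  have hPx := (hP (f x)).mdifferentiableAt (by simp)
  have hB : MDifferentiableAt 𝓘(ℝ, EN) 𝓘(ℝ, EN →L[ℝ] EN) (endoCoord (f x) P) (f x) :=
    ((mdifferentiableAt_hom_bundle _).1 hPx).2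
  have hBf : MDifferentiableAt 𝓘(ℝ, EM) 𝓘(ℝ, EN →L[ℝ] EN)
      (fun y => endoCoord (f x) P (f y)) x := hB.comp x hf
  have hE := mdifferentiableAt_extend (f x) (σ x)
  have hcE := ((diffAlongAt_iff (EN := EN) (f := fun q : N => q)).1 hE).2
  -- Parallelism is tested on the constant-coefficient extension of σ x. With B the matrix of P,
  -- after the rewriting this says that P applied to D of the extension is dB applied to the
  -- coefficients of σ x, plus D of the extension of P (σ x). It absorbs the dB term that the
  -- product rule produces for P σ.
  have h1 := connection_eq_mvfderiv_add D (hPx.clm_bundle_apply hE)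
    (mfderiv 𝓘(ℝ, EM) 𝓘(ℝ, EN) f x v)
  rw [hDP _ _ _ hE, mvfderiv_congr_of_eventuallyEq
    (coordAlong_endo (f := fun q : N => q) _ continuousAt_id), mvfderiv_clm_apply hB hcE,
    mvfderiv_congr_of_eventuallyEq (coordAlong_extend _ _), mvfderiv_const,
    FiberBundle.extend_apply_self] at h1
  rw [covAlong_eq, covAlong_eq, map_add, h1, mvfderiv_congr_of_eventuallyEq
    (coordAlong_endo _ hf.continuousAt), mvfderiv_clm_apply hBf hc]
  have h2 : mvfderiv 𝓘(ℝ, EM) (fun y => endoCoord (f x) P (f y)) x v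
      = mvfderiv 𝓘(ℝ, EN) (endoCoord (f x) P) (f x) (mfderiv 𝓘(ℝ, EM) 𝓘(ℝ, EN) f x v) := by
    have := mfderiv_comp x hB hf
    exact congrArg (fun A => A v) this
  rw [h2]
  simp only [map_add, symmL_endoCoord]
  have h3 : coordAlong (fun q : N => q) (f x)
      (FiberBundle.extend (E := (TangentSpace 𝓘(ℝ, EN) : N → Type _)) EN (σ x)) (f x)
      = coordAlong f x σ x := (coordAlong_extend (f x) (σ x)).self_of_nhds
  rw [h3]
  simp only [zero_apply, map_zero, add_zero]
  abel

end Pullback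

/-! ### Differentiability of the components in smooth subbundles. -/

section Subbundle

variable {EN : Type*} [NormedAddCommGroup EN] [NormedSpace ℝ EN]
  {N : Type*} [TopologicalSpace N] [ChartedSpace EN N] [IsManifold 𝓘(ℝ, EN) ∞ N]
  {EM : Type*} [NormedAddCommGroup EM] [NormedSpace ℝ EM]
  {M : Type*} [TopologicalSpace M] [ChartedSpace EM M]

theorem mdifferentiableAt_finset_sum {F : Type*} [NormedAddCommGroup F] [NormedSpace ℝ F]
    {ι : Type*} {s : Finset ι} {b : ι → M → F} {x : M}
    (hb : ∀ i, MDifferentiableAt 𝓘(ℝ, EM) 𝓘(ℝ, F) (b i) x) :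
    MDifferentiableAt 𝓘(ℝ, EM) 𝓘(ℝ, F) (fun y => ∑ i ∈ s, b i y) x := by
  classical
  induction s using Finset.induction_on with
  | empty => simpa using mdifferentiableAt_const
  | insert i s hi ih =>
    simp only [Finset.sum_insert hi]
    exact (hb i).add ih

/-- The coefficients of a differentiable map `c` into a vector space with respect to
differentiable families `b i`, independent at `x`, are differentiable. -/
theorem exists_mdifferentiableAt_coeff {F : Type*} [NormedAddCommGroup F] [NormedSpace ℝ F]
    [FiniteDimensional ℝ F] {ι : Type*} [Fintype ι] {b : ι → M → F} {c : M → F} {x : M}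
    (hb : ∀ i, MDifferentiableAt 𝓘(ℝ, EM) 𝓘(ℝ, F) (b i) x)
    (hc : MDifferentiableAt 𝓘(ℝ, EM) 𝓘(ℝ, F) c x)
    (hli : LinearIndependent ℝ (fun i => b i x)) :
    ∃ a : M → ι → ℝ, (∀ i, MDifferentiableAt 𝓘(ℝ, EM) 𝓘(ℝ, ℝ) (fun y => a y i) x) ∧
      ∀ᶠ y in 𝓝 x, ∀ t : ι → ℝ, c y = ∑ i, t i • b i y → a y = t := by
  classical
  let A : M → (ι → ℝ) →L[ℝ] F := fun y =>
    ∑ i, (ContinuousLinearMap.proj (R := ℝ) (φ := fun _ : ι => ℝ) i).smulRight (b i y)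
  have hA (y : M) (t : ι → ℝ) : A y t = ∑ i, t i • b i y := by simp [A]
  have hker : LinearMap.ker (A x).toLinearMap = ⊥ := by
    rw [LinearMap.ker_eq_bot']
    intro t ht
    exact funext (Fintype.linearIndependent_iff.1 hli t ((hA x t).symm.trans ht))
  -- The family need not span F, so `A x` is only injective. Composing with a fixed left inverse
  -- gives square operators equal to the identity at x, hence invertible nearby.
  obtain ⟨R₀, hR₀⟩ := (A x).toLinearMap.exists_leftInverse_of_injective hker
  let R : F →L[ℝ] (ι → ℝ) := LinearMap.toContinuousLinearMap R₀
  have hRA : R.comp (A x) = ContinuousLinearMap.id ℝ (ι → ℝ) := by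
    ext1 t
    exact LinearMap.congr_fun hR₀ t
  let B : M → (ι → ℝ) →L[ℝ] (ι → ℝ) := fun y => R.comp (A y)
  -- In this form B is visibly linear in the vectors `R (b i y)`, hence differentiable at x.
  have hBsum : B = fun y => ∑ i,
      ContinuousLinearMap.smulRightL ℝ (ι → ℝ) (ι → ℝ)
        (ContinuousLinearMap.proj (R := ℝ) (φ := fun _ : ι => ℝ) i) (R (b i y)) := by
    funext y
    ext1 t
    simp [B, hA]
  have hB : MDifferentiableAt 𝓘(ℝ, EM) 𝓘(ℝ, (ι → ℝ) →L[ℝ] (ι → ℝ)) B x := by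
    rw [hBsum]
    exact mdifferentiableAt_finset_sum fun i =>
      (((ContinuousLinearMap.smulRightL ℝ (ι → ℝ) (ι → ℝ)
        (ContinuousLinearMap.proj (R := ℝ) (φ := fun _ : ι => ℝ) i)).comp
        R).differentiableAt.mdifferentiableAt.comp x (hb i))
  have hBx : B x = (ContinuousLinearEquiv.refl ℝ (ι → ℝ) : (ι → ℝ) →L[ℝ] (ι → ℝ)) := hRA
  have hinv : MDifferentiableAt 𝓘(ℝ, EM) 𝓘(ℝ, (ι → ℝ) →L[ℝ] (ι → ℝ))
      (fun y => (B y).inverse) x := by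
    have h : DifferentiableAt ℝ
        (ContinuousLinearMap.inverse : ((ι → ℝ) →L[ℝ] (ι → ℝ)) → _) (B x) := by
      rw [hBx]
      exact (contDiffAt_map_inverse (n := 1) _).differentiableAt one_ne_zero
    exact h.mdifferentiableAt.comp x hB
  refine ⟨fun y => (B y).inverse (R (c y)),
    fun i => (ContinuousLinearMap.proj (R := ℝ) (φ := fun _ : ι => ℝ)
      i).differentiableAt.mdifferentiableAt.comp x
      (hinv.clm_apply (R.differentiableAt.mdifferentiableAt.comp x hc)), ?_⟩
  have hev : ∀ᶠ y in 𝓝 x, B y ∈ Set.range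
      ((↑) : ((ι → ℝ) ≃L[ℝ] (ι → ℝ)) → ((ι → ℝ) →L[ℝ] (ι → ℝ))) := by
    refine hB.continuousAt ?_
    rw [hBx]
    exact ContinuousLinearEquiv.nhds _
  filter_upwards [hev] with y ⟨e, he⟩ t ht
  have h1 : R (c y) = e t := by
    rw [ht, ← hA, ← ContinuousLinearEquiv.coe_coe, he]
    rfl
  rw [h1, ← he, ContinuousLinearMap.inverse_equiv]
  exact e.symm_apply_apply t

/-- If a differentiable section of `TN|_M` is the sum of sections of two independent smooth
subbundles, then the summands are differentiable. -/
theorem DiffAlongAt.left_of_add [FiniteDimensional ℝ EN] {f : M → N}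
    {B₁ B₂ : ∀ x : M, Submodule ℝ (TangentSpace 𝓘(ℝ, EN) (f x))}
    (h₁ : IsSmoothSubbundle EM B₁) (h₂ : IsSmoothSubbundle EM B₂)
    (hd : ∀ x, Disjoint (B₁ x) (B₂ x)) {σ τ : SectionAlong EN f}
    (hσ : ∀ x, σ x ∈ B₁ x) (hτ : ∀ x, τ x ∈ B₂ x) {x : M}
    (h : DiffAlongAt EM f (σ + τ) x) : DiffAlongAt EM f σ x := by
  obtain ⟨hf, hc⟩ := (diffAlongAt_iff (EN := EN)).1 h
  obtain ⟨U₁, k₁, s₁, hU₁, hx₁, hs₁, hB₁⟩ := h₁ x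
  obtain ⟨U₂, k₂, s₂, hU₂, hx₂, hs₂, hB₂⟩ := h₂ x
  let s : Fin k₁ ⊕ Fin k₂ → SectionAlong EN f := Sum.elim s₁ s₂
  have hs (i) : DiffAlongAt EM f (s i) x := by
    rcases i with i | i
    · exact ((hs₁ i).contMDiffAt (hU₁.mem_nhds hx₁)).mdifferentiableAt (by simp)
    · exact ((hs₂ i).contMDiffAt (hU₂.mem_nhds hx₂)).mdifferentiableAt (by simp)
  have hsc (i) := ((diffAlongAt_iff (EN := EN)).1 (hs i)).2
  have hli : LinearIndependent ℝ (fun i => coordAlong f x (s i) x) := by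
    have hx := FiberBundle.mem_baseSet_trivializationAt' (F := EN)
      (E := (TangentSpace 𝓘(ℝ, EN) : N → Type _)) (f x)
    have h0 : LinearIndependent ℝ (fun i => s i x) := by
      have : (fun i => s i x) = Sum.elim (fun i => s₁ i x) (fun i => s₂ i x) := by
        funext i; rcases i with i | i <;> rfl
      rw [this]
      refine (hB₁ x hx₁).1.sum_type (hB₂ x hx₂).1 ?_
      rw [(hB₁ x hx₁).2, (hB₂ x hx₂).2]
      exact hd x
    exact h0.map' ((trivializationAt EN (TangentSpace 𝓘(ℝ, EN) : N → Type _)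
      (f x)).continuousLinearEquivAt ℝ (f x) hx).toLinearEquiv.toLinearMap
      (LinearEquiv.ker _)
  obtain ⟨a, ha, hae⟩ := exists_mdifferentiableAt_coeff hsc hc hli
  refine (diffAlongAt_iff (EN := EN)).2 ⟨hf, ?_⟩
  have hsum : MDifferentiableAt 𝓘(ℝ, EM) 𝓘(ℝ, EN)
      (fun y => ∑ i, a y (Sum.inl i) • coordAlong f x (s₁ i) y) x := by
    exact mdifferentiableAt_finset_sum fun i => (ha (Sum.inl i)).smul (hsc (Sum.inl i))
  refine hsum.congr_of_eventuallyEq ?_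
  filter_upwards [hae, eventually_mem_baseSet EN hf.continuousAt, hU₁.mem_nhds hx₁,
    hU₂.mem_nhds hx₂] with y hy hyb hy₁ hy₂
  have e₁ := hσ y
  have e₂ := hτ y
  rw [← (hB₁ y hy₁).2] at e₁
  rw [← (hB₂ y hy₂).2] at e₂
  obtain ⟨t₁, ht₁⟩ := (Submodule.mem_span_range_iff_exists_fun ℝ).1 e₁
  obtain ⟨t₂, ht₂⟩ := (Submodule.mem_span_range_iff_exists_fun ℝ).1 e₂
  have hc₁ : coordAlong f x σ y = ∑ i, t₁ i • coordAlong f x (s₁ i) y := by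
    simp only [coordAlong_eq _ hyb, ← ht₁, map_sum, map_smul]
  have hc₂ : coordAlong f x τ y = ∑ i, t₂ i • coordAlong f x (s₂ i) y := by
    simp only [coordAlong_eq _ hyb, ← ht₂, map_sum, map_smul]
  -- Near x the differentiable coefficients `a` must agree with the pointwise frame coefficients of
  -- σ and τ, so the `Sum.inl` part of the sum recovers σ.
  have hay := hy (Sum.elim t₁ t₂) (by
    rw [Fintype.sum_sum_type]
    simp only [Sum.elim_inl, Sum.elim_inr, s]
    rw [← hc₁, ← hc₂]
    rw [coordAlong_eq (σ + τ) hyb, coordAlong_eq σ hyb, coordAlong_eq τ hyb]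
    exact map_add _ _ _)
  rw [hc₁, hay]
  simp

/-- A differentiable vector field of `M` is differentiable as a section of `TN|_M`. -/
theorem diffAlongAt_push [IsManifold 𝓘(ℝ, EM) ∞ M] {f : M → N}
    (hf : ContMDiff 𝓘(ℝ, EM) 𝓘(ℝ, EN) ∞ f)
    {W : ∀ x : M, TangentSpace 𝓘(ℝ, EM) x} {x : M}
    (hW : MDifferentiableAt 𝓘(ℝ, EM) 𝓘(ℝ, EM).tangent
      (fun x => (⟨x, W x⟩ : TangentBundle 𝓘(ℝ, EM) M)) x) :
    DiffAlongAt EM f (push (EN := EN) f W) x := by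
  have h := hf.contMDiff_tangentMap (m := ∞) (by simp)
  exact ((h _).mdifferentiableAt (by simp)).comp x hW

end Subbundle

/-! ### The splitting of the ambient tangent bundle along M. -/

section Splitting

variable {EN : Type*} [NormedAddCommGroup EN] [NormedSpace ℝ EN]
  {N : Type*} [TopologicalSpace N] [ChartedSpace EN N] [IsManifold 𝓘(ℝ, EN) ∞ N]
  {EM : Type*} [NormedAddCommGroup EM] [NormedSpace ℝ EM]
  {M : Type*} [TopologicalSpace M] [ChartedSpace EM M]
  {g : SemiRiemannianMetric EN N} {f : M → N} (L : LightlikeSubmanifold EM g f)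

namespace LightlikeSubmanifold

theorem screen_le_tan (x : M) : L.screen x ≤ tan EM f x :=
  le_sup_left.trans (L.screen_sup x).le

theorem toScreen_add_toRad {x : M} {v : TangentSpace 𝓘(ℝ, EN) (f x)} (hv : v ∈ tan EM f x) :
    L.toScreen x v + L.toRad x v = v := by
  rw [← L.screen_sup x] at hv
  obtain ⟨a, ha, b, hb, rfl⟩ := Submodule.mem_sup.1 hv
  rw [map_add, map_add, toScreen, toRad,
    Submodule.projection_apply_of_mem_left _ ha,
    Submodule.projection_apply_of_mem_right _ (Submodule.mem_sup_left hb),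
    Submodule.projection_apply_of_mem_right _ (Submodule.mem_sup_left ha),
    Submodule.projection_apply_of_mem_left _ hb]
  abel

theorem toTan_of_mem {x v} (hv : v ∈ tan EM f x) : L.toTan x v = v :=
  Submodule.projection_apply_of_mem_left _ hv

theorem toTan_of_mem_ltr {x v} (hv : v ∈ L.ltr x) : L.toTan x v = 0 :=
  Submodule.projection_apply_of_mem_right _ (Submodule.mem_sup_left hv)

theorem toTan_of_mem_screenTrans {x v} (hv : v ∈ L.screenTrans x) : L.toTan x v = 0 :=
  Submodule.projection_apply_of_mem_right _ (Submodule.mem_sup_right hv)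

theorem toLtr_of_mem {x v} (hv : v ∈ L.ltr x) : L.toLtr x v = v :=
  Submodule.projection_apply_of_mem_left _ hv

theorem toLtr_of_mem_tan {x v} (hv : v ∈ tan EM f x) : L.toLtr x v = 0 :=
  Submodule.projection_apply_of_mem_right _ (Submodule.mem_sup_right hv)

theorem toLtr_of_mem_screenTrans {x v} (hv : v ∈ L.screenTrans x) : L.toLtr x v = 0 :=
  Submodule.projection_apply_of_mem_right _ (Submodule.mem_sup_left hv)

theorem toScreenTrans_of_mem {x v} (hv : v ∈ L.screenTrans x) : L.toScreenTrans x v = v :=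
  Submodule.projection_apply_of_mem_left _ hv

theorem toScreenTrans_of_mem_tan {x v} (hv : v ∈ tan EM f x) : L.toScreenTrans x v = 0 :=
  Submodule.projection_apply_of_mem_right _ (Submodule.mem_sup_right hv)

theorem toScreenTrans_of_mem_ltr {x v} (hv : v ∈ L.ltr x) : L.toScreenTrans x v = 0 :=
  Submodule.projection_apply_of_mem_right _ (Submodule.mem_sup_left hv)

theorem toTan_add_toLtr_add_toScreenTrans (x : M) (v : TangentSpace 𝓘(ℝ, EN) (f x)) :
    L.toTan x v + L.toLtr x v + L.toScreenTrans x v = v := by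
  obtain ⟨a, ha, b, hb, rfl⟩ : ∃ a ∈ tan EM f x, ∃ b ∈ L.ltr x ⊔ L.screenTrans x, a + b = v :=
    Submodule.mem_sup.1 (by rw [(L.isCompl_tan x).sup_eq_top]; trivial)
  obtain ⟨l, hl, s, hs, rfl⟩ := Submodule.mem_sup.1 hb
  simp only [map_add, L.toTan_of_mem ha, L.toLtr_of_mem_tan ha, L.toScreenTrans_of_mem_tan ha,
    L.toTan_of_mem_ltr hl, L.toLtr_of_mem hl, L.toScreenTrans_of_mem_ltr hl,
    L.toTan_of_mem_screenTrans hs, L.toLtr_of_mem_screenTrans hs, L.toScreenTrans_of_mem hs]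
  abel

theorem screenTrans_le_orth_tan (x : M) : L.screenTrans x ≤ g.orth (tan EM f x) :=
  le_sup_left.trans (L.screenTrans_sup x).le

/-- A vector orthogonal to `S(TM)`, `Rad TM` and `ltr(TM)` lies in `S(TM^⊥)`. -/
theorem mem_screenTrans_of_orth {x : M} {z : TangentSpace 𝓘(ℝ, EN) (f x)}
    (ht : z ∈ g.orth (tan EM f x)) (hl : z ∈ g.orth (L.ltr x)) : z ∈ L.screenTrans x := by
  have hz := ht
  rw [← L.screenTrans_sup x] at hz
  obtain ⟨s, hs, ξ, hξ, rfl⟩ := Submodule.mem_sup.1 hz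
  -- The radical part ξ is orthogonal to TM and S(TM^⊥) because it is radical, and to ltr because z
  -- and s both are. Nondegeneracy then kills it.
  have h0 : ξ = 0 := by
    refine g.nondegenerate _ _ fun v => ?_
    rw [← L.toTan_add_toLtr_add_toScreenTrans x v, map_add, map_add]
    have h1 : g.val (f x) ξ (L.toTan x v) = 0 := hξ.2 _ (Submodule.projection_apply_mem _ _)
    have h2 : g.val (f x) ξ (L.toLtr x v) = 0 := by
      have hm : L.toLtr x v ∈ L.ltr x := Submodule.projection_apply_mem _ _
      have e1 := hl _ hm
      have e2 := L.ltr_orth_screenTrans x hm s hs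
      rw [g.symm] at e2
      simpa [e2] using e1
    have h3 : g.val (f x) ξ (L.toScreenTrans x v) = 0 := by
      rw [g.symm]
      exact L.screenTrans_le_orth_tan x (Submodule.projection_apply_mem _ _) ξ hξ.1
    rw [h1, h2, h3]
    simp
  rw [h0, add_zero]
  exact hs

end LightlikeSubmanifold

/-! ### The Golden structure acting on the splitting. -/

namespace LightlikeSubmanifold.IsRadicalTransversal

variable {L} {G : GoldenStructure g} 

theorem apply_mem_screen (hL : L.IsRadicalTransversal G)
    {x : M} {v : TangentSpace 𝓘(ℝ, EN) (f x)} (hv : v ∈ L.screen x) :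
    G.P (f x) v ∈ L.screen x := by
  rw [← hL.map_screen x]
  exact Submodule.mem_map_of_mem hv

theorem apply_mem_ltr (hL : L.IsRadicalTransversal G)
    {x : M} {v : TangentSpace 𝓘(ℝ, EN) (f x)} (hv : v ∈ rad EM g f x) :
    G.P (f x) v ∈ L.ltr x := by
  rw [← hL.map_rad x]
  exact Submodule.mem_map_of_mem hv

/-- Write v = Pξ with ξ radical; then P² = P + I gives Pv - v = ξ. -/
theorem apply_sub_self_mem_rad (hL : L.IsRadicalTransversal G)
    {x : M} {v : TangentSpace 𝓘(ℝ, EN) (f x)} (hv : v ∈ L.ltr x) :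
    G.P (f x) v - v ∈ rad EM g f x := by
  rw [← hL.map_rad x] at hv
  obtain ⟨ξ, hξ, rfl⟩ := hv
  have h := G.golden (f x) ξ
  change G.P (f x) (G.P (f x) ξ) - G.P (f x) ξ ∈ _
  rwa [h, add_sub_cancel_left]

/-- Self-adjointness moves P onto the test vector, and P maps S(TM), Rad and ltr into TM ⊕ ltr,
which is orthogonal to S(TM^⊥). -/
theorem apply_mem_screenTrans (hL : L.IsRadicalTransversal G)
    {x : M} {v : TangentSpace 𝓘(ℝ, EN) (f x)}
    (hv : v ∈ L.screenTrans x) : G.P (f x) v ∈ L.screenTrans x := by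
  have hlt {l} (hl : l ∈ L.ltr x) : g.val (f x) v l = 0 := by
    rw [g.symm]
    exact L.ltr_orth_screenTrans x hl v hv
  have htan := L.screenTrans_le_orth_tan x hv
  refine L.mem_screenTrans_of_orth (fun w hw => ?_) (fun w hw => ?_)
  · rw [← L.screen_sup x] at hw
    obtain ⟨a, ha, b, hb, rfl⟩ := Submodule.mem_sup.1 hw
    rw [G.compatible, map_add, map_add, hlt (hL.apply_mem_ltr hb),
      htan _ (L.screen_le_tan x (hL.apply_mem_screen ha)), add_zero]
  · rw [G.compatible, ← sub_add_cancel (G.P (f x) w) w, map_add, hlt hw,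
      htan _ (hL.apply_sub_self_mem_rad hw).1, add_zero]

/-- The components of `P v` in `TN|_M = TM ⊕ ltr(TM) ⊕ S(TM^⊥)`. -/
theorem components_apply (hL : L.IsRadicalTransversal G) (x : M) (v : TangentSpace 𝓘(ℝ, EN) (f x)) :
    L.toTan x (G.P (f x) v) = G.P (f x) (L.toScreen x (L.toTan x v))
        + L.toRad x (G.P (f x) (L.toLtr x v)) ∧
      L.toLtr x (G.P (f x) v) = G.P (f x) (L.toRad x (L.toTan x v))
        + L.toLtr x (G.P (f x) (L.toLtr x v)) ∧
      L.toScreenTrans x (G.P (f x) v) = G.P (f x) (L.toScreenTrans x v) := by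
  have ht : L.toTan x v ∈ tan EM f x := Submodule.projection_apply_mem _ _
  have hs := hL.apply_mem_screen (x := x) (v := L.toScreen x (L.toTan x v))
    (Submodule.projection_apply_mem _ _)
  have hr := hL.apply_mem_ltr (x := x) (v := L.toRad x (L.toTan x v))
    (Submodule.projection_apply_mem _ _)
  have hl : L.toLtr x v ∈ L.ltr x := Submodule.projection_apply_mem _ _
  have hlr := hL.apply_sub_self_mem_rad hl
  have hst := hL.apply_mem_screenTrans (x := x) (v := L.toScreenTrans x v)
    (Submodule.projection_apply_mem _ _)
  have hst' := L.screen_le_tan x hs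
  have hlt := hlr.1
  -- Every summand now lies in a single bundle; P of the ltr-component is the only one that must be
  -- split, into a radical and an ltr part.
  have e : G.P (f x) v = G.P (f x) (L.toScreen x (L.toTan x v))
      + G.P (f x) (L.toRad x (L.toTan x v))
      + ((G.P (f x) (L.toLtr x v) - L.toLtr x v) + L.toLtr x v)
      + G.P (f x) (L.toScreenTrans x v) := by
    rw [sub_add_cancel, ← map_add, L.toScreen_add_toRad ht, ← map_add, ← map_add,
      L.toTan_add_toLtr_add_toScreenTrans]
  have er : L.toRad x (G.P (f x) (L.toLtr x v)) = G.P (f x) (L.toLtr x v) - L.toLtr x v := by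
    conv_lhs => rw [← sub_add_cancel (G.P (f x) (L.toLtr x v)) (L.toLtr x v), map_add]
    rw [toRad, Submodule.projection_apply_of_mem_left _ hlr,
      Submodule.projection_apply_of_mem_right _ (Submodule.mem_sup_right
        (Submodule.mem_sup_left hl)), add_zero]
  have el : L.toLtr x (G.P (f x) (L.toLtr x v)) = L.toLtr x v := by
    conv_lhs => rw [← sub_add_cancel (G.P (f x) (L.toLtr x v)) (L.toLtr x v), map_add]
    rw [L.toLtr_of_mem_tan hlt, L.toLtr_of_mem hl, zero_add]
  refine ⟨?_, ?_, ?_⟩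
  · rw [er, e]
    simp only [map_add]
    rw [L.toTan_of_mem hst', L.toTan_of_mem_ltr hr, L.toTan_of_mem hlt, L.toTan_of_mem_ltr hl,
      L.toTan_of_mem_screenTrans hst]
    abel
  · rw [el, e]
    simp only [map_add]
    rw [L.toLtr_of_mem_tan hst', L.toLtr_of_mem hr, L.toLtr_of_mem_tan hlt, L.toLtr_of_mem hl,
      L.toLtr_of_mem_screenTrans hst]
    abel
  · rw [e]
    simp only [map_add]
    rw [L.toScreenTrans_of_mem_tan hst', L.toScreenTrans_of_mem_ltr hr,
      L.toScreenTrans_of_mem_tan hlt, L.toScreenTrans_of_mem_ltr hl,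
      L.toScreenTrans_of_mem hst]
    abel

end LightlikeSubmanifold.IsRadicalTransversal

/-- The derivative of a differentiable section `σ` of `TM` satisfies
`D_v (S σ) + D_v (L σ) = P (D_v σ)`. -/
theorem LightlikeSubmanifold.covAlong_opS_add_covAlong_opL [FiniteDimensional ℝ EN]
    (D : AffineConnection EN N) (G : GoldenStructure g) (hG : G.IsLocallyGolden D)
    {σ : SectionAlong EN f} (hσt : ∀ x, σ x ∈ tan EM f x) {x : M} (hσ : DiffAlongAt EM f σ x)
    (v : TangentSpace 𝓘(ℝ, EM) x) :
    covAlong EM D f (L.opS G σ) x v + covAlong EM D f (L.opL G σ) x v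
      = G.P (f x) (covAlong EM D f σ x v) := by
  let a : SectionAlong EN f := fun y => L.toScreen y (σ y)
  let b : SectionAlong EN f := fun y => L.toRad y (σ y)
  have hab : a + b = σ := funext fun y => L.toScreen_add_toRad (hσt y)
  have ha' (y) : a y ∈ L.screen y := Submodule.projection_apply_mem _ _
  have hb' (y) : b y ∈ rad EM g f y := Submodule.projection_apply_mem _ _
  have ha : DiffAlongAt EM f a x := DiffAlongAt.left_of_add L.smooth_screen L.smooth_rad
    L.screen_disjoint ha' hb' (by rwa [hab])
  have hb : DiffAlongAt EM f b x := DiffAlongAt.left_of_add L.smooth_rad L.smooth_screen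
    (fun y => (L.screen_disjoint y).symm) hb' ha' (by rwa [add_comm, hab])
  change covAlong EM D f (fun y => G.P (f y) (a y)) x v
    + covAlong EM D f (fun y => G.P (f y) (b y)) x v = _
  rw [covAlong_endo D G.contMDiff hG ha, covAlong_endo D G.contMDiff hG hb, ← map_add,
    ← add_apply, ← covAlong_add D ha hb, hab]

end Splitting

end GoldenLightlike

end

/-! ### Comparison of components. -/

theorem mainTheorem3
    {EN : Type*} [NormedAddCommGroup EN] [NormedSpace ℝ EN] [FiniteDimensional ℝ EN]
    {N : Type*} [TopologicalSpace N] [ChartedSpace EN N] [IsManifold 𝓘(ℝ, EN) ∞ N]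
    {EM : Type*} [NormedAddCommGroup EM] [NormedSpace ℝ EM] [FiniteDimensional ℝ EM]
    {M : Type*} [TopologicalSpace M] [ChartedSpace EM M] [IsManifold 𝓘(ℝ, EM) ∞ M]
    (g : GoldenLightlike.SemiRiemannianMetric EN N)
    (D : GoldenLightlike.AffineConnection EN N) (hD : GoldenLightlike.IsLeviCivita g D)
    (G : GoldenLightlike.GoldenStructure g) (hG : G.IsLocallyGolden D)
    (f : M → N) (L : GoldenLightlike.LightlikeSubmanifold EM g f)
    (hL : L.IsRadicalTransversal G)
    (W U : ∀ x : M, TangentSpace 𝓘(ℝ, EM) x)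
    (hW : ContMDiff 𝓘(ℝ, EM) 𝓘(ℝ, EM).tangent ∞
      (fun x => (⟨x, W x⟩ : TangentBundle 𝓘(ℝ, EM) M)))
    (hU : ContMDiff 𝓘(ℝ, EM) 𝓘(ℝ, EM).tangent ∞
      (fun x => (⟨x, U x⟩ : TangentBundle 𝓘(ℝ, EM) M))) :
    let w : GoldenLightlike.SectionAlong EN f := GoldenLightlike.push f W
    (∀ x, L.nablaS D U G w x
        = L.shape D U (L.opL G w) x + L.toRad x (G.P (f x) (L.hl D U w x))) ∧
    (∀ x, L.hs D U (L.opS G w) x + L.Ds D U (L.opL G w) x - G.P (f x) (L.hs D U w x) = 0) ∧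
    (∀ x, L.hl D U (L.opS G w) x + L.nablaL D U (L.opL G w) x - L.opL G (L.nabla D U w) x
        - L.toLtr x (G.P (f x) (L.hl D U w x)) = 0) := by
  intro w
  have key (x : M) : GoldenLightlike.covAlong EM D f (L.opS G w) x (U x) + GoldenLightlike.covAlong EM D f (L.opL G w) x (U x)
      = G.P (f x) (GoldenLightlike.covAlong EM D f w x (U x)) :=
    L.covAlong_opS_add_covAlong_opL D G hG (fun y => ⟨W y, rfl⟩)
      (GoldenLightlike.diffAlongAt_push L.immersion.contMDiff
        ((hW x).mdifferentiableAt (by simp))) (U x)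
  refine ⟨fun x => ?_, fun x => ?_, fun x => ?_⟩
  · have h := (hL.components_apply x (GoldenLightlike.covAlong EM D f w x (U x))).1
    rw [← key, map_add] at h
    -- The tangential part of D_U(Lw) is -A_{Lw}U, so moving it to the other side yields the shape
    -- operator with a plus sign.
    exact (sub_eq_iff_eq_add.2 ((eq_sub_of_add_eq h).trans (by
      simp only [GoldenLightlike.LightlikeSubmanifold.opS,
        GoldenLightlike.LightlikeSubmanifold.nabla, GoldenLightlike.LightlikeSubmanifold.shape,
        GoldenLightlike.LightlikeSubmanifold.hl]
      abel)))
  · have h := (hL.components_apply x (GoldenLightlike.covAlong EM D f w x (U x))).2.2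
    rw [← key, map_add] at h
    exact sub_eq_zero.2 h
  · have h := (hL.components_apply x (GoldenLightlike.covAlong EM D f w x (U x))).2.1
    rw [← key, map_add] at h
    exact sub_eq_zero.2 (sub_eq_iff_eq_add'.2 h)
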